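/- Let $M$ be a smooth $n$-dimensional manifold with a smooth Lorentzian metric $g$ of signature $(-,+,\dots,+)$ and Levi-Civita connection $\nabla$. Let $Z$ be a smooth vector field on $M$ that is covariantly constant, $\nabla Z=0$, and null, i.e. $Z_x\neq 0$ and $g_x(Z_x,Z_x)=0$ for every $x\in M$. Then every point $p\in M$ has an open neighbourhood $U$ which is the domain of a smooth coordinate chart $\varphi=(u,v,x^1,\dots,x^{n-2})$ of $M$ (in particular $n\ge 2$) such that $$Z|_U=\partial_v=\operatorname{grad}u ,$$ where $\partial_v$ is the coordinate vector field of $v$ in the chart $\varphi$, and $\operatorname{grad}u$ is the gradient of $u$ with respect to $g$, defined by $g(\operatorname{grad}u,X)=du(X)$ for all tangent vectors $X$. -/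

import Mathlib

open Bundle Manifold ContDiff VectorField

noncomputable section

/-- A smooth Lorentzian metric, of signature `(-, +, …, +)`, on a smooth `n`-manifold without
boundary. -/
structure LorentzMetric (n : ℕ) (M : Type*) [TopologicalSpace M]
    [ChartedSpace (EuclideanSpace ℝ (Fin n)) M] [IsManifold (𝓡 n) ∞ M] where
  /-- The bilinear form on each tangent space. -/
  val (x : M) : TangentSpace (𝓡 n) x →L[ℝ] TangentSpace (𝓡 n) x →L[ℝ] ℝ
  symm (x : M) (v w : TangentSpace (𝓡 n) x) : val x v w = val x w v
  signature (x : M) : ∃ (e : Module.Basis (Fin n) ℝ (TangentSpace (𝓡 n) x)) (i₀ : Fin n),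
    ∀ i j, val x (e i) (e j) = if i = j then (if i = i₀ then -1 else 1) else 0
  contMDiff : ContMDiff (𝓡 n)
    ((𝓡 n).prod 𝓘(ℝ, EuclideanSpace ℝ (Fin n) →L[ℝ] EuclideanSpace ℝ (Fin n) →L[ℝ] ℝ)) ∞
    (fun x ↦ TotalSpace.mk' (EuclideanSpace ℝ (Fin n) →L[ℝ] EuclideanSpace ℝ (Fin n) →L[ℝ] ℝ)
      (E := fun x : M ↦ TangentSpace (𝓡 n) x →L[ℝ] TangentSpace (𝓡 n) x →L[ℝ] ℝ) x (val x))

namespace LorentzMetric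

variable {n : ℕ} {M : Type*} [TopologicalSpace M] [ChartedSpace (EuclideanSpace ℝ (Fin n)) M]
  [IsManifold (𝓡 n) ∞ M] (g : LorentzMetric n M)

/-! ### Raising indices -/

theorem eq_zero_of_forall (x : M) (v : TangentSpace (𝓡 n) x) (h : ∀ w, g.val x v w = 0) :
    v = 0 := by
  obtain ⟨e, i₀, he⟩ := g.signature x
  have hv : ∀ j, e.repr v j = 0 := by
    intro j
    have h1 := h (e j)
    rw [← e.sum_repr v] at h1
    simp only [map_sum, map_smul, _root_.sum_apply, _root_.smul_apply,
      he, smul_eq_mul, mul_ite, mul_zero, Finset.sum_ite_eq', Finset.mem_univ, if_true] at h1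
    split_ifs at h1 <;> simpa using h1
  rw [← e.sum_repr v]
  simp [hv]

/-- Lowering an index, `v ↦ g(v, ·)`, as a linear isomorphism `T_x M ≃ T_x^* M`. -/
def flat (x : M) : TangentSpace (𝓡 n) x ≃ₗ[ℝ] (TangentSpace (𝓡 n) x →L[ℝ] ℝ) :=
  haveI : FiniteDimensional ℝ (TangentSpace (𝓡 n) x) :=
    inferInstanceAs (FiniteDimensional ℝ (EuclideanSpace ℝ (Fin n)))
  haveI : T2Space (TangentSpace (𝓡 n) x) :=
    inferInstanceAs (T2Space (EuclideanSpace ℝ (Fin n)))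
  LinearEquiv.ofInjectiveOfFinrankEq (g.val x : TangentSpace (𝓡 n) x →ₗ[ℝ] _)
    ((injective_iff_map_eq_zero _).2 fun v hv ↦
      g.eq_zero_of_forall x v fun w ↦ congrArg (fun f : TangentSpace (𝓡 n) x →L[ℝ] ℝ ↦ f w) hv)
    ((Subspace.dual_finrank_eq (K := ℝ) (V := TangentSpace (𝓡 n) x)).symm.trans
      (LinearMap.toContinuousLinearMap (𝕜 := ℝ) (E := TangentSpace (𝓡 n) x)
        (F' := ℝ)).finrank_eq)

/-- Raising an index: the vector `α^♯` determined by `g(α^♯, w) = α(w)` for all `w`. -/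
def sharp (x : M) (α : TangentSpace (𝓡 n) x →L[ℝ] ℝ) : TangentSpace (𝓡 n) x :=
  (g.flat x).symm α

theorem val_sharp (x : M) (α : TangentSpace (𝓡 n) x →L[ℝ] ℝ) (w : TangentSpace (𝓡 n) x) :
    g.val x (g.sharp x α) w = α w := by
  have h : g.flat x (g.sharp x α) = α := (g.flat x).apply_symm_apply α
  exact congrArg (fun f : TangentSpace (𝓡 n) x →L[ℝ] ℝ ↦ f w) h

/-- The gradient of a function: `g(grad f, w) = df(w)`. -/
def grad (f : M → ℝ) (x : M) : TangentSpace (𝓡 n) x := g.sharp x (mvfderiv (𝓡 n) f x)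

/-! ### The Levi-Civita connection, through the Koszul formula -/

/-- Differentiability at a point of a vector field, as a section of the tangent bundle. -/
abbrev VFDiffAt (X : Π x : M, TangentSpace (𝓡 n) x) (x : M) : Prop :=
  MDifferentiableAt (𝓡 n) ((𝓡 n).prod 𝓘(ℝ, EuclideanSpace ℝ (Fin n)))
    (fun y ↦ TotalSpace.mk' (EuclideanSpace ℝ (Fin n)) y (X y)) x

theorem mdifferentiableAt_val {X Y : Π x : M, TangentSpace (𝓡 n) x} {x : M}
    (hX : VFDiffAt X x) (hY : VFDiffAt Y x) :
    MDifferentiableAt (𝓡 n) 𝓘(ℝ) (fun y ↦ g.val y (X y) (Y y)) x := by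
  have : MDifferentiableAt (𝓡 n) ((𝓡 n).prod 𝓘(ℝ))
      (fun m ↦ TotalSpace.mk' ℝ (E := Bundle.Trivial M ℝ) m (g.val m (X m) (Y m))) x := by
    apply MDifferentiableAt.clm_bundle_apply₂ (F₁ := EuclideanSpace ℝ (Fin n))
      (F₂ := EuclideanSpace ℝ (Fin n))
    · exact (g.contMDiff x).mdifferentiableAt (by simp)
    · exact hX
    · exact hY
  simp only [mdifferentiableAt_totalSpace] at this
  exact this.2

/-- The right-hand side of the Koszul formula for `2 g(∇_X Y, W)` at `x`. -/
def koszul (X Y W : Π x : M, TangentSpace (𝓡 n) x) (x : M) : ℝ :=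
  mvfderiv (𝓡 n) (fun y ↦ g.val y (Y y) (W y)) x (X x) + mvfderiv (𝓡 n) (fun y ↦ g.val y (X y) (W y)) x (Y x)
    - mvfderiv (𝓡 n) (fun y ↦ g.val y (X y) (Y y)) x (W x)
    + g.val x (mlieBracket (𝓡 n) X Y x) (W x)
    - g.val x (mlieBracket (𝓡 n) X W x) (Y x)
    - g.val x (mlieBracket (𝓡 n) Y W x) (X x)

theorem tensorialAt_koszul_left {Y W : Π x : M, TangentSpace (𝓡 n) x} {x : M}
    (hY : VFDiffAt Y x) (hW : VFDiffAt W x) :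
    TensorialAt (𝓡 n) (EuclideanSpace ℝ (Fin n)) (fun X ↦ g.koszul X Y W x) x where
  smul {f X} hf hX := by
    simp [koszul, mlieBracket_smul_left hf hX,
      mvfderiv_fun_mul hf (g.mdifferentiableAt_val hX hW),
      mvfderiv_fun_mul hf (g.mdifferentiableAt_val hX hY)]
    ring
  add {X X'} hX hX' := by
    simp [koszul, mlieBracket_add_left hX hX',
      mvfderiv_fun_add (g.mdifferentiableAt_val hX hW) (g.mdifferentiableAt_val hX' hW),
      mvfderiv_fun_add (g.mdifferentiableAt_val hX hY) (g.mdifferentiableAt_val hX' hY)]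
    ring

theorem tensorialAt_koszul_right {X Y : Π x : M, TangentSpace (𝓡 n) x} {x : M}
    (hX : VFDiffAt X x) (hY : VFDiffAt Y x) :
    TensorialAt (𝓡 n) (EuclideanSpace ℝ (Fin n)) (fun W ↦ g.koszul X Y W x) x where
  smul {f W} hf hW := by
    simp [koszul, mlieBracket_smul_right hf hW,
      mvfderiv_fun_mul hf (g.mdifferentiableAt_val hX hW),
      mvfderiv_fun_mul hf (g.mdifferentiableAt_val hY hW)]
    rw [g.symm x (W x) (Y x), g.symm x (W x) (X x)]
    ring
  add {W W'} hW hW' := by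
    simp [koszul, mlieBracket_add_right hW hW',
      mvfderiv_fun_add (g.mdifferentiableAt_val hX hW) (g.mdifferentiableAt_val hX hW'),
      mvfderiv_fun_add (g.mdifferentiableAt_val hY hW) (g.mdifferentiableAt_val hY hW')]
    ring

theorem koszul_add {X Y Y' W : Π x : M, TangentSpace (𝓡 n) x} {x : M}
    (hX : VFDiffAt X x) (hY : VFDiffAt Y x) (hY' : VFDiffAt Y' x)
    (hW : VFDiffAt W x) :
    g.koszul X (Y + Y') W x = g.koszul X Y W x + g.koszul X Y' W x := by
  simp [koszul, mlieBracket_add_right hY hY', mlieBracket_add_left hY hY',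
    mvfderiv_fun_add (g.mdifferentiableAt_val hX hY) (g.mdifferentiableAt_val hX hY'),
    mvfderiv_fun_add (g.mdifferentiableAt_val hY hW) (g.mdifferentiableAt_val hY' hW)]
  ring

theorem koszul_smul {X Y W : Π x : M, TangentSpace (𝓡 n) x} {f : M → ℝ} {x : M}
    (hX : VFDiffAt X x) (hY : VFDiffAt Y x) (hf : MDifferentiableAt (𝓡 n) 𝓘(ℝ) f x)
    (hW : VFDiffAt W x) :
    g.koszul X (f • Y) W x
      = f x * g.koszul X Y W x + 2 * (mvfderiv (𝓡 n) f x (X x) * g.val x (Y x) (W x)) := by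
  simp [koszul, mlieBracket_smul_right hf hY, mlieBracket_smul_left hf hY,
    mvfderiv_fun_mul hf (g.mdifferentiableAt_val hX hY),
    mvfderiv_fun_mul hf (g.mdifferentiableAt_val hY hW)]
  rw [g.symm x (Y x) (X x)]
  ring

/-- The index-raising isomorphism as a continuous linear map. -/
def sharpL (x : M) : (TangentSpace (𝓡 n) x →L[ℝ] ℝ) →L[ℝ] TangentSpace (𝓡 n) x :=
  haveI : FiniteDimensional ℝ (TangentSpace (𝓡 n) x) :=
    inferInstanceAs (FiniteDimensional ℝ (EuclideanSpace ℝ (Fin n)))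
  haveI : T2Space (TangentSpace (𝓡 n) x) :=
    inferInstanceAs (T2Space (EuclideanSpace ℝ (Fin n)))
  haveI : FiniteDimensional ℝ (TangentSpace (𝓡 n) x →L[ℝ] ℝ) :=
    (g.flat x).finiteDimensional
  LinearMap.toContinuousLinearMap (g.flat x).symm.toLinearMap

theorem sharpL_apply (x : M) (α : TangentSpace (𝓡 n) x →L[ℝ] ℝ) :
    g.sharpL x α = g.sharp x α := rfl

open Classical in
/-- The covariant derivative `v ↦ ∇_v Y` at `x` of a vector field `Y` differentiable at `x`,
determined by the Koszul formula (and zero by convention when `Y` is not differentiable at `x`). -/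
def leviCivitaAux (Y : Π x : M, TangentSpace (𝓡 n) x) (x : M) :
    TangentSpace (𝓡 n) x →L[ℝ] TangentSpace (𝓡 n) x :=
  if hY : VFDiffAt Y x then
    g.sharpL x ∘L ((1 / 2 : ℝ) • TensorialAt.mkHom₂ (fun X W ↦ g.koszul X Y W x) x
      (fun _ hW ↦ g.tensorialAt_koszul_left hY hW) (fun _ hX ↦ g.tensorialAt_koszul_right hX hY))
  else 0

/-- The Koszul formula. -/
theorem val_leviCivitaAux {X Y W : Π x : M, TangentSpace (𝓡 n) x} {x : M}
    (hX : VFDiffAt X x) (hY : VFDiffAt Y x) (hW : VFDiffAt W x) :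
    g.val x (g.leviCivitaAux Y x (X x)) (W x) = 1 / 2 * g.koszul X Y W x := by
  rw [leviCivitaAux, dif_pos hY, ContinuousLinearMap.comp_apply, sharpL_apply, val_sharp]
  change (1 / 2 : ℝ) * _ = _
  exact congrArg (fun t : ℝ ↦ 1 / 2 * t) (TensorialAt.mkHom₂_apply
    (fun _ hW ↦ g.tensorialAt_koszul_left hY hW) (fun _ hX ↦ g.tensorialAt_koszul_right hX hY)
    hX hW)

theorem ext_of_extend {x : M} {A B : TangentSpace (𝓡 n) x →L[ℝ] TangentSpace (𝓡 n) x}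
    (h : ∀ X W : Π x : M, TangentSpace (𝓡 n) x, VFDiffAt X x → VFDiffAt W x →
      g.val x (A (X x)) (W x) = g.val x (B (X x)) (W x)) : A = B := by
  ext1 v
  rw [← sub_eq_zero]
  apply g.eq_zero_of_forall x
  intro w
  have := h (FiberBundle.extend (EuclideanSpace ℝ (Fin n)) v)
    (FiberBundle.extend (EuclideanSpace ℝ (Fin n)) w)
    (FiberBundle.mdifferentiableAt_extend ..) (FiberBundle.mdifferentiableAt_extend ..)
  simp only [FiberBundle.extend_apply_self] at this
  simp [this]

/-- The Levi-Civita connection of a Lorentzian metric. -/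
def leviCivita : CovariantDerivative (𝓡 n) (EuclideanSpace ℝ (Fin n))
    (TangentSpace (𝓡 n) : M → Type _) where
  toFun := g.leviCivitaAux
  isCovariantDerivativeOnUniv :=
    { add := by
        intro Y Y' x hY hY' _
        apply g.ext_of_extend
        intro X W hX hW
        have hYY : VFDiffAt (Y + Y') x := mdifferentiableAt_add_section hY hY'
        rw [g.val_leviCivitaAux hX hYY hW, g.koszul_add hX hY hY' hW]
        simp only [_root_.add_apply, map_add]
        rw [g.val_leviCivitaAux hX hY hW, g.val_leviCivitaAux hX hY' hW]
        ring
      leibniz := by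
        intro Y f x hY hf _
        apply g.ext_of_extend
        intro X W hX hW
        have hfY : VFDiffAt (f • Y) x := hf.smul_section hY
        rw [g.val_leviCivitaAux hX hfY hW, g.koszul_smul hX hY hf hW]
        simp only [_root_.add_apply, map_add, _root_.smul_apply, map_smul,
          ContinuousLinearMap.smulRight_apply, smul_eq_mul]
        rw [g.val_leviCivitaAux hX hY hW]
        ring }

/-- The Levi-Civita connection is torsion-free. -/
theorem leviCivita_torsion : g.leviCivita.torsion = 0 := by
  rw [CovariantDerivative.torsion_eq_zero_iff]
  intro X Y x hX hY
  rw [← sub_eq_zero]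
  apply g.eq_zero_of_forall x
  intro w
  have hW : VFDiffAt (FiberBundle.extend (EuclideanSpace ℝ (Fin n)) w) x :=
    FiberBundle.mdifferentiableAt_extend ..
  have h1 := g.val_leviCivitaAux hX hY hW
  have h2 := g.val_leviCivitaAux hY hX hW
  have h3 : mlieBracket (𝓡 n) Y X x = - mlieBracket (𝓡 n) X Y x := mlieBracket_swap_apply
  have h4 : (fun y ↦ g.val y (Y y) (X y)) = fun y ↦ g.val y (X y) (Y y) :=
    funext fun y ↦ g.symm y _ _
  simp only [koszul, FiberBundle.extend_apply_self, h3, h4, map_neg, _root_.neg_apply] at h1 h2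
  change g.val x (g.leviCivitaAux Y x (X x) - g.leviCivitaAux X x (Y x) - _) w = 0
  simp only [map_sub, _root_.sub_apply, h1, h2]
  ring

/-- The Levi-Civita connection is compatible with the metric. -/
theorem leviCivita_metric {X Y W : Π x : M, TangentSpace (𝓡 n) x} {x : M}
    (hX : VFDiffAt X x) (hY : VFDiffAt Y x) (hW : VFDiffAt W x) :
    mvfderiv (𝓡 n) (fun y ↦ g.val y (Y y) (W y)) x (X x)
      = g.val x (g.leviCivita Y x (X x)) (W x) + g.val x (Y x) (g.leviCivita W x (X x)) := by
  have h1 := g.val_leviCivitaAux hX hY hW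
  have h2 := g.val_leviCivitaAux hX hW hY
  have h3 : mlieBracket (𝓡 n) W Y x = - mlieBracket (𝓡 n) Y W x := mlieBracket_swap_apply
  have h4 : (fun y ↦ g.val y (W y) (Y y)) = fun y ↦ g.val y (Y y) (W y) :=
    funext fun y ↦ g.symm y _ _
  rw [g.symm x (Y x)]
  change _ = g.val x (g.leviCivitaAux Y x (X x)) (W x) + g.val x (g.leviCivitaAux W x (X x)) (Y x)
  rw [h1, h2]
  simp only [koszul, h3, h4, map_neg, _root_.neg_apply]
  ring

/-! ### Null and covariantly constant vector fields; coordinate vector fields -/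

/-- A vector field is null if at every point it is a nonzero vector `v` with `g(v, v) = 0`
(the zero vector counts as spacelike). -/
def IsNull (Z : Π x : M, TangentSpace (𝓡 n) x) : Prop :=
  ∀ x, Z x ≠ 0 ∧ g.val x (Z x) (Z x) = 0

/-- `∇ Z = 0` for the Levi-Civita connection. -/
def IsCovariantlyConstant (Z : Π x : M, TangentSpace (𝓡 n) x) : Prop :=
  ∀ x, g.leviCivita Z x = 0

end LorentzMetric

/-- The `i`-th coordinate function of a chart. -/
def chartCoord {n : ℕ} {M : Type*} [TopologicalSpace M]
    (φ : OpenPartialHomeomorph M (EuclideanSpace ℝ (Fin n))) (i : Fin n) (x : M) : ℝ := φ x i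

/-- The `i`-th coordinate vector field of a chart: the pullback under the chart of the constant
field `e_i`, so that `dφ (∂_i) = e_i` on the domain of the chart. -/
def coordField {n : ℕ} {M : Type*} [TopologicalSpace M]
    [ChartedSpace (EuclideanSpace ℝ (Fin n)) M]
    (φ : OpenPartialHomeomorph M (EuclideanSpace ℝ (Fin n))) (i : Fin n) (x : M) :
    TangentSpace (𝓡 n) x :=
  mpullback (𝓡 n) (𝓡 n) φ
    (fun y ↦ (NormedSpace.fromTangentSpace y).symm (EuclideanSpace.single i (1 : ℝ))) x

end

/-! Let α = g(Z, ·). The connection is metric and torsion-free, so ∇Z = 0 makes α closed. By the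
Poincaré lemma α = du on a coordinate ball, and nondegeneracy of g turns this into Z = grad u and
gives du ≠ 0. Nullity says du(Z) = g(Z, Z) = 0: u is constant along the integral curves of Z. Hence
Z can be straightened to a coordinate field ∂_v while u is kept as a different coordinate.

Closedness is `IsCovariantlyConstant.mvfderiv_val_comm`, put in coordinates by
`IsCovariantlyConstant.fderiv_chartDual_comm`. The coordinates come from
`exists_adapted_openPartialHomeomorph`, which takes the straightening map of
`ContDiffOn.exists_straightening`, normalises it linearly and replaces one component by u.

Straightening rests on a flow that is jointly smooth in time and initial point,
`ContDiff.exists_contDiffOn_flow`. Rescaled to unit time, the integral equation of the flow is an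
equation in the Banach space C([0,1], E), smooth in all its data by
`ContinuousMap.contDiff_postcomp`; the inverse function theorem solves it with smooth dependence on
the data. -/

open Set Filter Topology

section Analysis

universe u

/-! ### Smoothness of γ ↦ f ∘ γ on spaces of continuous functions -/

section Postcomp

set_option synthInstance.maxHeartbeats 400000

variable {K E F : Type*} [TopologicalSpace K] [CompactSpace K]
  [NormedAddCommGroup E] [NormedSpace ℝ E] [NormedAddCommGroup F] [NormedSpace ℝ F]

/-- Pointwise application of a family of continuous linear maps to a family of vectors, as a
continuous bilinear map on spaces of continuous functions. -/
noncomputable def ContinuousMap.applyL : C(K, E →L[ℝ] F) →L[ℝ] C(K, E) →L[ℝ] C(K, F) :=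
  LinearMap.mkContinuous₂
    (LinearMap.mk₂ ℝ (fun (A : C(K, E →L[ℝ] F)) (h : C(K, E)) ↦
        (⟨fun k ↦ A k (h k), by fun_prop⟩ : C(K, F)))
      (fun _ _ _ ↦ by ext; simp) (fun _ _ _ ↦ by ext; simp)
      (fun _ _ _ ↦ by ext; simp) (fun _ _ _ ↦ by ext; simp)) 1
    (fun A h ↦ by
      rw [one_mul, ContinuousMap.norm_le _ (by positivity)]
      intro k
      exact (A k).le_of_opNorm_le_of_le (A.norm_coe_le_norm k) (h.norm_coe_le_norm k))

@[simp]
theorem ContinuousMap.applyL_apply (A : C(K, E →L[ℝ] F)) (h : C(K, E)) (k : K) :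
    ContinuousMap.applyL A h k = A k (h k) := rfl

/-- The mean value inequality is applied at each point k; compactness of K enters through the sup
norm, which makes the modulus δ independent of k. -/
theorem ContinuousMap.hasFDerivAt_postcomp {f : E → F} (hf : ContDiff ℝ 1 f) (γ : C(K, E)) :
    HasFDerivAt (fun γ : C(K, E) ↦ (ContinuousMap.mk f hf.continuous).comp γ)
      (ContinuousMap.applyL
        ((ContinuousMap.mk (fderiv ℝ f) (hf.continuous_fderiv one_ne_zero)).comp γ)) γ := by
  rw [hasFDerivAt_iff_isLittleO_nhds_zero, Asymptotics.isLittleO_iff]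
  intro ε hε
  have hc : Continuous fun γ : C(K, E) ↦
      (ContinuousMap.mk (fderiv ℝ f) (hf.continuous_fderiv one_ne_zero)).comp γ :=
    ContinuousMap.continuous_postcomp _
  obtain ⟨δ, hδ, hball⟩ := (Metric.continuous_iff (α := C(K, E)) (β := C(K, E →L[ℝ] F))).1 hc γ ε hε
  filter_upwards [Metric.ball_mem_nhds (0 : C(K, E)) hδ] with h hh
  rw [mem_ball_zero_iff] at hh
  rw [ContinuousMap.norm_le _ (by positivity)]
  intro k
  have hbound : ∀ y ∈ Metric.ball (γ k) δ, ‖fderiv ℝ f y - fderiv ℝ f (γ k)‖ ≤ ε := by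
    intro y hy
    -- Translating γ by the constant y - γ k gives a function through y that is δ-close to γ, so
    -- continuity of postcomposition with `fderiv ℝ f` bounds the derivative at y.
    have h1 : dist (γ + ContinuousMap.const K (y - γ k)) γ < δ := by
      rw [dist_eq_norm, add_sub_cancel_left]
      refine lt_of_le_of_lt ?_ (mem_ball_iff_norm.1 hy)
      rw [ContinuousMap.norm_le _ (norm_nonneg _)]
      simp
    have h2 := (ContinuousMap.dist_apply_le_dist k).trans (hball _ h1).le
    simpa [dist_eq_norm] using h2
  have hk : ‖h k‖ ≤ ‖h‖ := h.norm_coe_le_norm k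
  have := (convex_ball (γ k) δ).norm_image_sub_le_of_norm_hasFDerivWithin_le'
    (f := f) (f' := fderiv ℝ f) (φ := fderiv ℝ f (γ k)) (C := ε)
    (x := γ k) (y := γ k + h k)
    (fun y _ ↦ ((hf.differentiable one_ne_zero) y).hasFDerivAt.hasFDerivWithinAt) hbound
    (Metric.mem_ball_self hδ) (by simpa [mem_ball_iff_norm] using hk.trans_lt hh)
  simp only [add_sub_cancel_left] at this
  calc _ ≤ ε * ‖h k‖ := by simpa using this
    _ ≤ _ := by gcongr

/-- The derivative is `applyL` after postcomposition with `fderiv ℝ f`, so the induction passes from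
f to its derivative. The codomain changes to `E →L[ℝ] F`, which is why F is quantified inside the
induction and shares a universe with E. -/
theorem ContinuousMap.contDiff_postcomp_nat {E : Type u} [NormedAddCommGroup E]
    [NormedSpace ℝ E] (m : ℕ) : ∀ {F : Type u} [NormedAddCommGroup F] [NormedSpace ℝ F]
      {f : E → F} (hf : ContDiff ℝ m f),
      ContDiff ℝ m (fun γ : C(K, E) ↦ (ContinuousMap.mk f hf.continuous).comp γ) := by
  induction m with
  | zero =>
    intro F _ _ f hf
    exact contDiff_zero.2 (ContinuousMap.continuous_postcomp _)
  | succ m ih =>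
    intro F _ _ f hf
    have hf1 : ContDiff ℝ 1 f := hf.of_le (by exact_mod_cast Nat.le_add_left 1 m)
    have hf' : ContDiff ℝ m (fderiv ℝ f) := hf.fderiv_right (by exact_mod_cast le_rfl)
    push_cast
    rw [contDiff_succ_iff_hasFDerivAt]
    exact ⟨_, ContinuousMap.applyL.contDiff.comp (ih hf'), ContinuousMap.hasFDerivAt_postcomp hf1⟩

/-- Postcomposition with a smooth map is a smooth map between spaces of continuous functions. -/
theorem ContinuousMap.contDiff_postcomp {E F : Type u} [NormedAddCommGroup E]
    [NormedSpace ℝ E] [NormedAddCommGroup F] [NormedSpace ℝ F] {f : E → F}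
    (hf : ContDiff ℝ ∞ f) :
    ContDiff ℝ ∞ (fun γ : C(K, E) ↦ (ContinuousMap.mk f hf.continuous).comp γ) :=
  contDiff_infty.2 fun m ↦ ContinuousMap.contDiff_postcomp_nat m (contDiff_infty.1 hf m)

end Postcomp

/-! ### Inverse function theorem -/

section InverseFunction

variable {E F : Type*} [NormedAddCommGroup E] [NormedSpace ℝ E] [CompleteSpace E]
  [NormedAddCommGroup F] [NormedSpace ℝ F]

/-- The inverse function theorem for smooth maps, with a local inverse that is smooth on its whole
domain. -/
theorem ContDiffOn.exists_openPartialHomeomorph {f : E → F} {U : Set E} (hU : IsOpen U)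
    (hf : ContDiffOn ℝ ∞ f U) {a : E} (ha : a ∈ U) {A : E ≃L[ℝ] F}
    (hA : HasFDerivAt f (A : E →L[ℝ] F) a) :
    ∃ e : OpenPartialHomeomorph E F, ⇑e = f ∧ a ∈ e.source ∧ e.source ⊆ U ∧
      ContDiffOn ℝ ∞ e.symm e.target ∧
      ∀ x ∈ e.source, ∃ B : E ≃L[ℝ] F, HasFDerivAt f (B : E →L[ℝ] F) x := by
  have hfa : ∀ x ∈ U, ContDiffAt ℝ ∞ f x := fun x hx ↦ hf.contDiffAt (hU.mem_nhds hx)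
  have hcont : ContinuousOn (fderiv ℝ f) U := hf.continuousOn_fderiv_of_isOpen hU (by simp)
  -- Invertible operators form an open set. Restricting to points with invertible derivative makes
  -- the inverse smooth on the whole target, not only at the image of a.
  have hV : IsOpen (U ∩ fderiv ℝ f ⁻¹' range ((↑) : (E ≃L[ℝ] F) → E →L[ℝ] F)) :=
    hcont.isOpen_inter_preimage hU ContinuousLinearEquiv.isOpen
  set V := U ∩ fderiv ℝ f ⁻¹' range ((↑) : (E ≃L[ℝ] F) → E →L[ℝ] F)
  have haV : a ∈ V := ⟨ha, A, hA.fderiv.symm⟩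
  let e₀ := (hfa a ha).toOpenPartialHomeomorph f hA (by simp)
  have hderiv : ∀ x ∈ V, ∃ B : E ≃L[ℝ] F, HasFDerivAt f (B : E →L[ℝ] F) x := by
    rintro x ⟨hx, B, hB⟩
    exact ⟨B, hB ▸ ((hfa x hx).differentiableAt (by simp)).hasFDerivAt⟩
  have hsub : (e₀.restrOpen V hV).source ⊆ V := inter_subset_right
  refine ⟨e₀.restrOpen V hV, rfl,
    ⟨(hfa a ha).mem_toOpenPartialHomeomorph_source hA (by simp), haV⟩,
    hsub.trans inter_subset_left, ?_, fun x hx ↦ hderiv x (hsub hx)⟩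
  intro y hy
  have hx := hsub ((e₀.restrOpen V hV).map_target hy)
  obtain ⟨B, hB⟩ := hderiv _ hx
  exact ((e₀.restrOpen V hV).contDiffAt_symm hy hB (hfa _ hx.1)).contDiffWithinAt

end InverseFunction

/-! ### The integral operator on curves -/

section Flow

variable {E : Type u} [NormedAddCommGroup E] [NormedSpace ℝ E]

/-- The primitive vanishing at `0` of a continuous function on the unit interval. -/
noncomputable def ContinuousMap.primitiveL : C(Icc (0 : ℝ) 1, E) →L[ℝ] C(Icc (0 : ℝ) 1, E) :=
  LinearMap.mkContinuous
    { toFun := fun γ ↦ ⟨fun s ↦ ∫ r in (0 : ℝ)..s, Set.IccExtend zero_le_one γ r,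
        (intervalIntegral.continuous_primitive
          (fun _ _ ↦ (γ.continuous.Icc_extend' (h := zero_le_one)).intervalIntegrable _ _) 0).comp
          continuous_subtype_val⟩
      map_add' := fun γ₁ γ₂ ↦ by
        ext s
        exact intervalIntegral.integral_add
          ((γ₁.continuous.Icc_extend' (h := zero_le_one)).intervalIntegrable _ _)
          ((γ₂.continuous.Icc_extend' (h := zero_le_one)).intervalIntegrable _ _)
      map_smul' := fun c γ ↦ by
        ext s
        exact intervalIntegral.integral_smul c _ } 1
    (fun γ ↦ by
      rw [one_mul, ContinuousMap.norm_le _ (norm_nonneg _)]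
      intro s
      refine (intervalIntegral.norm_integral_le_of_norm_le_const
        (fun r _ ↦ γ.norm_coe_le_norm (projIcc 0 1 zero_le_one r))).trans ?_
      have : |(s : ℝ) - 0| ≤ 1 := by rw [sub_zero, abs_of_nonneg s.2.1]; exact s.2.2
      nlinarith [norm_nonneg γ])

theorem ContinuousMap.primitiveL_apply (γ : C(Icc (0 : ℝ) 1, E)) (s : Icc (0 : ℝ) 1) :
    ContinuousMap.primitiveL γ s = ∫ r in (0 : ℝ)..s, Set.IccExtend zero_le_one γ r := rfl

end Flow

end Analysis

/-! ### Smooth local flows -/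

section Flow

universe u

variable {E : Type u} [NormedAddCommGroup E] [NormedSpace ℝ E]

/-- If `γ` solves the integral equation of `γ' = t f(γ)`, then `s ↦ γ (σ s)` solves that of
`γ' = σ t f(γ)`. -/
theorem ContinuousMap.comp_scale_eq_primitiveL {f : C(E, E)} {x : E} {t : ℝ}
    {γ : C(Icc (0 : ℝ) 1, E)}
    (h : γ = ContinuousMap.const _ x + t • ContinuousMap.primitiveL (f.comp γ))
    (σ : Icc (0 : ℝ) 1) (m : C(Icc (0 : ℝ) 1, Icc (0 : ℝ) 1)) (hm : ∀ s, (m s : ℝ) = σ * s) :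
    γ.comp m = ContinuousMap.const _ x +
      (σ * t) • ContinuousMap.primitiveL (f.comp (γ.comp m)) := by
  ext s
  have h1 : γ (m s) = x + t • ContinuousMap.primitiveL (f.comp γ) (m s) :=
    congrArg (fun c : C(Icc (0 : ℝ) 1, E) ↦ c (m s)) h
  have h2 : ∫ r in (0 : ℝ)..s, Set.IccExtend zero_le_one (f.comp (γ.comp m)) r =
      ∫ r in (0 : ℝ)..s, Set.IccExtend zero_le_one (f.comp γ) (σ * r) := by
    refine intervalIntegral.integral_congr fun r hr ↦ ?_
    rw [uIcc_of_le s.2.1] at hr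
    have hr' : r ∈ Icc (0 : ℝ) 1 := ⟨hr.1, hr.2.trans s.2.2⟩
    have hσr : (σ * r : ℝ) ∈ Icc (0 : ℝ) 1 := unitInterval.mul_mem σ.2 hr'
    have hmr : m ⟨r, hr'⟩ = ⟨σ * r, hσr⟩ := Subtype.ext (hm _)
    change Set.IccExtend _ _ r = Set.IccExtend _ _ _
    rw [IccExtend_of_mem _ _ hr', IccExtend_of_mem _ _ hσr]
    simp only [ContinuousMap.comp_apply, hmr]
  have h3 := intervalIntegral.smul_integral_comp_mul_left (a := 0) (b := (s : ℝ))
    (Set.IccExtend zero_le_one (f.comp γ)) (σ : ℝ)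
  simp only [ContinuousMap.comp_apply, ContinuousMap.add_apply, ContinuousMap.const_apply,
    ContinuousMap.smul_apply] at h1 ⊢
  rw [h1, ContinuousMap.primitiveL_apply, ContinuousMap.primitiveL_apply, h2, mul_comm, mul_smul,
    h3, hm, mul_zero]

variable [CompleteSpace E]

/-- A smooth vector field has a smooth local flow. -/
theorem ContDiff.exists_contDiffOn_flow {f : E → E} (hf : ContDiff ℝ ∞ f) (p : E) :
    ∃ (Φ : ℝ × E → E) (V : Set (ℝ × E)), IsOpen V ∧ (0, p) ∈ V ∧ ContDiffOn ℝ ∞ Φ V ∧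
      (∀ z ∈ V, z.1 = 0 → Φ z = z.2) ∧
      ∀ z ∈ V, HasDerivAt (fun t ↦ Φ (t, z.2)) (f (Φ z)) z.1 := by
  let fC : C(E, E) := ⟨f, hf.continuous⟩
  let cst : E →L[ℝ] C(Icc (0 : ℝ) 1, E) := ContinuousLinearMap.const ℝ _
  -- The second component vanishes exactly when γ solves γ' = t f(γ), γ(0) = x in integral form,
  -- that is, when γ is the trajectory of x up to time t, rescaled to [0,1].
  let G : (ℝ × E) × C(Icc (0 : ℝ) 1, E) → (ℝ × E) × C(Icc (0 : ℝ) 1, E) := fun z ↦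
    (z.1, z.2 - cst z.1.2 - z.1.1 • ContinuousMap.primitiveL (fC.comp z.2))
  have hN : ContDiff ℝ ∞ fun γ : C(Icc (0 : ℝ) 1, E) ↦ ContinuousMap.primitiveL (fC.comp γ) :=
    ContinuousMap.primitiveL.contDiff.comp (ContinuousMap.contDiff_postcomp hf)
  have hG : ContDiff ℝ ∞ G := by
    refine contDiff_fst.prodMk ((contDiff_snd.sub ?_).sub (ContDiff.fun_smul ?_ ?_))
    · exact cst.contDiff.comp (contDiff_snd.comp contDiff_fst)
    · exact contDiff_fst.comp contDiff_fst
    · exact hN.comp contDiff_snd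
  let z₀ : (ℝ × E) × C(Icc (0 : ℝ) 1, E) := ((0, p), cst p)
  -- Off-diagonal block of the derivative of G. At t = 0 the integral term contributes nothing in
  -- the γ direction, so the diagonal blocks are identities and the derivative is invertible.
  let B : (ℝ × E) →L[ℝ] C(Icc (0 : ℝ) 1, E) := - (cst ∘L .snd ℝ ℝ E) -
    (ContinuousLinearMap.fst ℝ ℝ E).smulRight (ContinuousMap.primitiveL (fC.comp (cst p)))
  let A : ((ℝ × E) × C(Icc (0 : ℝ) 1, E)) ≃L[ℝ] ((ℝ × E) × C(Icc (0 : ℝ) 1, E)) :=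
    (ContinuousLinearEquiv.refl ℝ (ℝ × E)).skewProd
      (ContinuousLinearEquiv.refl ℝ C(Icc (0 : ℝ) 1, E)) B
  have hA : HasFDerivAt G (A : _ →L[ℝ] _) z₀ := by
    have h1 : HasFDerivAt (fun z : (ℝ × E) × C(Icc (0 : ℝ) 1, E) ↦
        ContinuousMap.primitiveL (fC.comp z.2)) _ z₀ :=
      HasFDerivAt.comp (g := fun γ ↦ ContinuousMap.primitiveL (fC.comp γ)) z₀
        ((hN.differentiable (by simp)) (cst p)).hasFDerivAt hasFDerivAt_snd
    have h2 : HasFDerivAt (fun z : (ℝ × E) × C(Icc (0 : ℝ) 1, E) ↦ z.1.1) _ z₀ :=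
      (hasFDerivAt_fst (𝕜 := ℝ) (p := z₀)).fst
    have h3 : HasFDerivAt (fun z : (ℝ × E) × C(Icc (0 : ℝ) 1, E) ↦ cst z.1.2) _ z₀ :=
      cst.hasFDerivAt.comp z₀ (hasFDerivAt_fst (𝕜 := ℝ) (p := z₀)).snd
    have h4 := (hasFDerivAt_fst (𝕜 := ℝ) (p := z₀)).prodMk
      ((hasFDerivAt_snd.sub h3).sub (h2.smul h1))
    refine h4.congr_fderiv ?_
    refine ContinuousLinearMap.ext fun z ↦ Prod.ext (by simp [A]) ?_
    simp [A, B, z₀]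
    abel
  obtain ⟨e, he, hz₀, -, hsymm, -⟩ :=
    hG.contDiffOn.exists_openPartialHomeomorph isOpen_univ (mem_univ z₀) hA
  obtain ⟨r, hr, hball⟩ := Metric.isOpen_iff.1 e.open_source z₀ hz₀
  let ι : ℝ × E → (ℝ × E) × C(Icc (0 : ℝ) 1, E) := fun z ↦ (z, 0)
  have hι : ContDiff ℝ ∞ ι := contDiff_id.prodMk contDiff_const
  have hW : IsOpen (ι ⁻¹' e.target) := e.open_target.preimage hι.continuous
  let Γ : ℝ × E → C(Icc (0 : ℝ) 1, E) := fun z ↦ (e.symm (ι z)).2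
  have hΓ : ContDiffOn ℝ ∞ Γ (ι ⁻¹' e.target) :=
    contDiff_snd.comp_contDiffOn (hsymm.comp hι.contDiffOn fun _ h ↦ h)
  have hGz₀ : G z₀ = ι (0, p) := by simp [G, z₀, ι]
  have hmem₀ : ι (0, p) ∈ e.target := by
    rw [← hGz₀, ← he]; exact e.map_source hz₀
  have hΓ₀ : Γ (0, p) = cst p := by
    simp only [Γ]
    rw [← hGz₀, ← he, e.left_inv hz₀]
  have hsol : ∀ z ∈ ι ⁻¹' e.target,
      Γ z = ContinuousMap.const _ z.2 + z.1 • ContinuousMap.primitiveL (fC.comp (Γ z)) := by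
    intro z hz
    have h1 : G (e.symm (ι z)) = ι z := by rw [← he]; exact e.right_inv hz
    have h2 : (e.symm (ι z)).1 = z := congrArg Prod.fst h1
    have h3 : Γ z - cst (e.symm (ι z)).1.2 -
      (e.symm (ι z)).1.1 • ContinuousMap.primitiveL (fC.comp (Γ z)) = 0 := congrArg Prod.snd h1
    rw [h2, sub_sub, sub_eq_zero] at h3
    exact h3
  -- Both (t, x) and its solution are confined to balls of radius r, so that rescaled solutions stay
  -- in `e.source`, where G is injective.
  let V₀ : Set (ℝ × E) := ι ⁻¹' e.target ∩ Γ ⁻¹' Metric.ball (cst p) r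
  have hV₀ : IsOpen V₀ := hΓ.continuousOn.isOpen_inter_preimage hW Metric.isOpen_ball
  let V : Set (ℝ × E) := V₀ ∩ Metric.ball (0, p) r
  have hV : IsOpen V := hV₀.inter Metric.isOpen_ball
  -- The solution for time t, reparametrised by s, solves the equation for time s t; injectivity of
  -- G on `e.source` identifies it with the solution chosen there.
  have hscale : ∀ z ∈ V, ∀ s : Icc (0 : ℝ) 1, Γ (s * z.1, z.2) ⟨1, by simp⟩ = Γ z s := by
    intro z hz s
    let m : C(Icc (0 : ℝ) 1, Icc (0 : ℝ) 1) :=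
      ⟨fun r ↦ ⟨s * r, unitInterval.mul_mem s.2 r.2⟩, by fun_prop⟩
    have h1 := ContinuousMap.comp_scale_eq_primitiveL (hsol z hz.1.1) s m fun _ ↦ rfl
    have h2 : ((s * z.1, z.2), (Γ z).comp m) ∈ e.source := by
      apply hball
      rw [← ball_prod_same, ← ball_prod_same]
      have hz2 := hz.2
      rw [← ball_prod_same] at hz2
      refine ⟨⟨?_, hz2.2⟩, ?_⟩
      · have h3 : |z.1| < r := by simpa using hz2.1
        have h4 : |(s : ℝ) * z.1| ≤ |z.1| := by
          rw [abs_mul, abs_of_nonneg s.2.1]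
          exact mul_le_of_le_one_left (abs_nonneg _) s.2.2
        simpa [z₀] using lt_of_le_of_lt h4 h3
      · have h3 : Dist.dist (Γ z) (cst p) < r := hz.1.2
        refine lt_of_le_of_lt ?_ h3
        rw [ContinuousMap.dist_le dist_nonneg]
        intro r
        exact ContinuousMap.dist_apply_le_dist (f := Γ z) (g := cst p) (m r)
    have h3 : G ((s * z.1, z.2), (Γ z).comp m) = ι (s * z.1, z.2) := by
      refine Prod.ext rfl ?_
      change (Γ z).comp m - ContinuousMap.const _ z.2 -
        ((s : ℝ) * z.1) • ContinuousMap.primitiveL (fC.comp ((Γ z).comp m)) = 0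
      rw [sub_sub, sub_eq_zero]
      exact h1
    have h4 : Γ (s * z.1, z.2) = (Γ z).comp m := by
      simp only [Γ]
      rw [← h3, ← he, e.left_inv h2]
    rw [h4]
    exact congrArg (Γ z) (Subtype.ext (mul_one _))
  have hΦ : ContDiffOn ℝ ∞ (fun z ↦ Γ z ⟨1, by simp⟩) V :=
    (ContinuousMap.evalCLM (M := E) ℝ (⟨1, by simp⟩ : Icc (0 : ℝ) 1)).contDiff.comp_contDiffOn
      (hΓ.mono fun z (hz : z ∈ V) ↦ hz.1.1)
  refine ⟨fun z ↦ Γ z ⟨1, by simp⟩, V, hV, ⟨⟨hmem₀, ?_⟩, Metric.mem_ball_self hr⟩, hΦ, ?_, ?_⟩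
  · rw [mem_preimage, hΓ₀]; exact Metric.mem_ball_self hr
  · intro z hz h0
    have := congrArg (fun c : C(Icc (0 : ℝ) 1, E) ↦ c ⟨1, by simp⟩) (hsol z hz.1.1)
    simpa [h0] using this
  · intro z hz
    -- it suffices to differentiate along a solution with nonzero time through the given point
    obtain ⟨t₁, s, ht₁, hzt, hst⟩ : ∃ (t₁ : ℝ) (s : Icc (0 : ℝ) 1), t₁ ≠ 0 ∧ (t₁, z.2) ∈ V ∧
        s * t₁ = z.1 := by
      by_cases h0 : z.1 = 0
      · have hc : Continuous fun t : ℝ ↦ (t, z.2) := by fun_prop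
        have hn : ∀ᶠ t in 𝓝[≠] (0 : ℝ), (t, z.2) ∈ V := by
          refine ((hc.tendsto 0).eventually (hV.mem_nhds ?_)).filter_mono
            nhdsWithin_le_nhds
          rw [← h0]; exact hz
        obtain ⟨t, ht, ht0⟩ := (hn.and self_mem_nhdsWithin).exists
        exact ⟨t, ⟨0, by simp⟩, ht0, ht, by simp [h0]⟩
      · exact ⟨z.1, ⟨1, by simp⟩, h0, hz, one_mul _⟩
    have hdiff : DifferentiableAt ℝ (fun t ↦ Γ (t, z.2) ⟨1, by simp⟩) z.1 :=
      ((hΦ.contDiffAt (hV.mem_nhds hz)).differentiableAt (by simp)).comp (f := fun t ↦ (t, z.2))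
        z.1 (by fun_prop)
    have hD := hdiff.hasDerivAt
    set D := deriv (fun t ↦ Γ (t, z.2) ⟨1, by simp⟩) z.1
    have h1 : HasDerivAt (fun σ : ℝ ↦ Γ (σ * t₁, z.2) ⟨1, by simp⟩) (t₁ • D) s := by
      have h2 : HasDerivAt (fun σ : ℝ ↦ σ * t₁) t₁ s := by
        simpa using (hasDerivAt_id (s : ℝ)).mul_const t₁
      exact HasDerivAt.scomp_of_eq (s : ℝ) hD h2 hst.symm
    have hcont : Continuous (IccExtend zero_le_one (fC.comp (Γ (t₁, z.2)))) :=
      (fC.comp (Γ (t₁, z.2))).continuous.Icc_extend'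
    have h2 : HasDerivAt (fun σ : ℝ ↦ z.2 + t₁ • ∫ r in (0 : ℝ)..σ,
        IccExtend zero_le_one (fC.comp (Γ (t₁, z.2))) r) (t₁ • f (Γ (t₁, z.2) s)) s := by
      have := ((hcont.integral_hasStrictDerivAt 0 s).hasDerivAt.const_smul t₁).const_add z.2
      rwa [IccExtend_of_mem _ _ s.2] at this
    -- The same curve is differentiated through the integral equation, which is available only for σ
    -- in [0,1]. One-sided derivatives suffice at the endpoints, and t₁ ≠ 0 is cancelled afterwards.
    have h3 : HasDerivWithinAt (fun σ : ℝ ↦ Γ (σ * t₁, z.2) ⟨1, by simp⟩)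
        (t₁ • f (Γ (t₁, z.2) s)) (Icc 0 1) s := by
      refine h2.hasDerivWithinAt.congr_of_mem (fun σ hσ ↦ ?_) s.2
      have h4 := congrArg (fun c : C(Icc (0 : ℝ) 1, E) ↦ c ⟨σ, hσ⟩) (hsol _ hzt.1.1)
      exact (hscale _ hzt ⟨σ, hσ⟩).trans h4
    have h5 : t₁ • D = t₁ • f (Γ (t₁, z.2) s) :=
      (uniqueDiffOn_Icc zero_lt_one _ s.2).eq_deriv _ h1.hasDerivWithinAt h3
    have h6 : D = f (Γ z ⟨1, by simp⟩) := by
      rw [smul_right_injective E ht₁ h5, ← hscale _ hzt s]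
      simp only [hst]
    rw [← h6]
    exact hD

end Flow

/-! ### Straightening a nonvanishing vector field -/

section Straightening

variable {E : Type*} [NormedAddCommGroup E] [NormedSpace ℝ E]

/-- Multiplication by a bump function supported inside U. It serves to apply the flow theorem, which
asks for a globally smooth field. -/
theorem ContDiffOn.exists_contDiff_eventuallyEq [HasContDiffBump E] {F : Type*}
    [NormedAddCommGroup F] [NormedSpace ℝ F] {f : E → F} {U : Set E} (hU : IsOpen U)
    (hf : ContDiffOn ℝ ∞ f U) {p : E} (hp : p ∈ U) :
    ∃ f' : E → F, ContDiff ℝ ∞ f' ∧ f' =ᶠ[𝓝 p] f := by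
  obtain ⟨r, hr, hball⟩ := Metric.isOpen_iff.1 hU p hp
  let χ : ContDiffBump p := ⟨r / 4, r / 2, by positivity, by linarith⟩
  refine ⟨fun x ↦ χ x • f x, contDiff_iff_contDiffAt.2 fun x ↦ ?_, ?_⟩
  · by_cases hx : x ∈ U
    · exact χ.contDiffAt.smul (hf.contDiffAt (hU.mem_nhds hx))
    · have hx' : x ∈ (Metric.closedBall p (r / 2))ᶜ := fun h ↦
        hx (hball (Metric.closedBall_subset_ball (by linarith) h))
      refine (contDiffAt_const (c := (0 : F))).congr_of_eventuallyEq ?_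
      filter_upwards [Metric.isClosed_closedBall.isOpen_compl.mem_nhds hx'] with y hy
      rw [χ.zero_of_le_dist (not_le.1 fun h ↦ hy h).le, zero_smul]
  · filter_upwards [χ.eventuallyEq_one] with x hx
    simp [hx]

/-- Local straightening of a smooth vector field at a point where it does not vanish: there is a
smooth map, tangent to the identity at `p`, which maps `f` to the constant field `f p`. -/
theorem ContDiffOn.exists_straightening [FiniteDimensional ℝ E] {f : E → E} {U : Set E}
    (hU : IsOpen U) (hf : ContDiffOn ℝ ∞ f U) {p : E} (hp : p ∈ U) (h0 : f p ≠ 0) :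
    ∃ (Ξ : E → E) (V : Set E), IsOpen V ∧ p ∈ V ∧ V ⊆ U ∧ ContDiffOn ℝ ∞ Ξ V ∧
      HasFDerivAt Ξ (ContinuousLinearMap.id ℝ E) p ∧ ∀ x ∈ V, fderiv ℝ Ξ x (f x) = f p := by
  have : CompleteSpace E := FiniteDimensional.complete ℝ E
  obtain ⟨f', hf', hff'⟩ := hf.exists_contDiff_eventuallyEq hU hp
  obtain ⟨W, hWU, hW, hpW⟩ := mem_nhds_iff.1 (inter_mem hff' (hU.mem_nhds hp))
  obtain ⟨Φ, V, hV, hpV, hΦ, hΦ0, hΦd⟩ := hf'.exists_contDiffOn_flow p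
  obtain ⟨ℓ, hℓ⟩ := SeparatingDual.exists_eq_one (R := ℝ) h0
  -- Since ℓ (f p) = 1, this splits y into a flow time and a point of the hyperplane p + ker ℓ
  -- transverse to f p. The map Φ ∘ κ flows out from that hyperplane, and its local inverse is the
  -- straightening.
  let κ : E → ℝ × E := fun y ↦ (ℓ (y - p), y - ℓ (y - p) • f p)
  have hκ : ContDiff ℝ ∞ κ := by fun_prop
  have hκp : κ p = (0, p) := by simp [κ]
  have hV' : IsOpen (κ ⁻¹' V) := hV.preimage hκ.continuous
  have hpV' : p ∈ κ ⁻¹' V := by rwa [mem_preimage, hκp]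
  have hΘ : ContDiffOn ℝ ∞ (Φ ∘ κ) (κ ⁻¹' V) := hΦ.comp hκ.contDiffOn fun _ h ↦ h
  have hΘd : ∀ y ∈ κ ⁻¹' V, DifferentiableAt ℝ (Φ ∘ κ) y := fun y hy ↦
    (hΘ.contDiffAt (hV'.mem_nhds hy)).differentiableAt (by simp)
  have hΘp : (Φ ∘ κ) p = p := by
    rw [Function.comp_apply, hκp]; exact hΦ0 _ hpV rfl
  -- the direction of `f p` is mapped to the vector field
  have hdir : ∀ y ∈ κ ⁻¹' V, fderiv ℝ (Φ ∘ κ) y (f p) = f' ((Φ ∘ κ) y) := by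
    intro y hy
    have h1 : HasDerivAt (fun t : ℝ ↦ y + t • f p) (f p) 0 := by
      simpa using ((hasDerivAt_id (0 : ℝ)).smul_const (f p)).const_add y
    have h2 : HasDerivAt (fun t : ℝ ↦ (Φ ∘ κ) (y + t • f p)) (fderiv ℝ (Φ ∘ κ) y (f p)) 0 :=
      HasFDerivAt.comp_hasDerivAt_of_eq (0 : ℝ) (hΘd y hy).hasFDerivAt h1 (by simp)
    have h3 : (fun t : ℝ ↦ (Φ ∘ κ) (y + t • f p)) = fun t ↦ Φ ((κ y).1 + t, (κ y).2) := by
      funext t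
      have hL : ℓ (y + t • f p - p) = ℓ (y - p) + t := by
        simp only [map_add, map_sub, map_smul, hℓ, smul_eq_mul]; ring
      simp only [Function.comp_apply, κ, hL, add_smul]
      congr 2
      abel
    have h4 : HasDerivAt (fun t : ℝ ↦ Φ ((κ y).1 + t, (κ y).2)) (f' (Φ (κ y))) 0 := by
      have := hΦd (κ y) hy
      rw [← add_zero (κ y).1] at this
      exact HasDerivAt.comp_const_add (κ y).1 0 this
    rw [h3] at h2
    exact h2.unique h4
  have hid : HasFDerivAt (Φ ∘ κ) (ContinuousLinearEquiv.refl ℝ E : E →L[ℝ] E) p := by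
    refine (hΘd p hpV').hasFDerivAt.congr_fderiv (ContinuousLinearMap.ext fun h ↦ ?_)
    -- On the hyperplane the flow time is 0, so Φ ∘ κ fixes its points near p and its derivative is
    -- the identity on ker ℓ.
    have hker : fderiv ℝ (Φ ∘ κ) p (h - ℓ h • f p) = h - ℓ h • f p := by
      set w := h - ℓ h • f p with hw
      have hℓw : ℓ w = 0 := by simp [hw, hℓ]
      have h1 : HasDerivAt (fun t : ℝ ↦ p + t • w) w 0 := by
        simpa using ((hasDerivAt_id (0 : ℝ)).smul_const w).const_add p
      have h2 : HasDerivAt (fun t : ℝ ↦ (Φ ∘ κ) (p + t • w)) (fderiv ℝ (Φ ∘ κ) p w) 0 :=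
        HasFDerivAt.comp_hasDerivAt_of_eq (0 : ℝ) (hΘd p hpV').hasFDerivAt h1 (by simp)
      have h3 : (fun t : ℝ ↦ (Φ ∘ κ) (p + t • w)) =ᶠ[𝓝 0] fun t ↦ p + t • w := by
        have hc : Tendsto (fun t : ℝ ↦ p + t • w) (𝓝 0) (𝓝 p) := by
          simpa using h1.continuousAt.tendsto
        filter_upwards [hc (hV'.mem_nhds hpV')] with t ht
        have hκt : κ (p + t • w) = (0, p + t • w) := by simp [κ, hℓw]
        rw [mem_preimage, mem_preimage, hκt] at ht
        rw [Function.comp_apply, hκt]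
        exact hΦ0 _ ht rfl
      exact (h2.congr_of_eventuallyEq h3.symm).unique h1
    have h5 := hdir p hpV'
    rw [hΘp, hff'.self_of_nhds] at h5
    have h6 : h = (h - ℓ h • f p) + ℓ h • f p := by abel
    conv_lhs => rw [h6]
    rw [map_add, hker, map_smul, h5]
    simp
  obtain ⟨e, he, hpe, heV, hsymm, hB⟩ := hΘ.exists_openPartialHomeomorph hV' hpV' hid
  have hpt : p ∈ e.target := by
    have := e.map_source hpe
    rwa [he, hΘp] at this
  have hep : e.symm p = p := by
    conv_lhs => rw [← hΘp, ← he]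
    exact e.left_inv hpe
  refine ⟨e.symm, e.target ∩ W, e.open_target.inter hW, ⟨hpt, hpW⟩, fun x hx ↦ (hWU hx.2).2,
    hsymm.mono inter_subset_left, ?_, ?_⟩
  · have := e.hasFDerivAt_symm (f' := ContinuousLinearEquiv.refl ℝ E) hpt
      (by rw [hep, he]; exact hid)
    exact this
  · intro x hx
    have hy := e.map_target hx.1
    obtain ⟨B, hB⟩ := hB _ hy
    have h1 : HasFDerivAt e (B : E →L[ℝ] E) (e.symm x) := by rw [he]; exact hB
    rw [(e.hasFDerivAt_symm hx.1 h1).fderiv]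
    have h2 := hdir _ (heV hy)
    rw [hB.fderiv, ← he, e.right_inv hx.1, show f' x = f x from (hWU hx.2).1] at h2
    rw [← h2]
    simp

end Straightening

/-! ### Coordinates adapted to a function and a field -/

section AdaptedChart

variable {n : ℕ}

/-- A nonzero vector `v` and a nonzero linear form `α` with `α v = 0` can be brought simultaneously
to the normal form `v = e₁`, `α = e₀^*`. -/
theorem exists_continuousLinearEquiv_normalForm (hn : 2 ≤ n)
    {α : EuclideanSpace ℝ (Fin n) →L[ℝ] ℝ} {v : EuclideanSpace ℝ (Fin n)} (hα : α ≠ 0)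
    (hv : v ≠ 0) (hαv : α v = 0) :
    ∃ L : EuclideanSpace ℝ (Fin n) ≃L[ℝ] EuclideanSpace ℝ (Fin n),
      L v = EuclideanSpace.single ⟨1, hn⟩ 1 ∧
      ∀ w, L w ⟨0, Nat.zero_lt_of_lt hn⟩ = α w := by
  let i₀ : Fin n := ⟨0, Nat.zero_lt_of_lt hn⟩
  let i₁ : Fin n := ⟨1, hn⟩
  have hi : i₁ ≠ i₀ := by simp [i₀, i₁]
  obtain ⟨L₀, hL₀⟩ := SeparatingDual.exists_continuousLinearEquiv_apply_eq (R := ℝ) hv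
    (show EuclideanSpace.single i₁ (1 : ℝ) ≠ 0 by simp)
  have hL₀s : L₀.symm (EuclideanSpace.single i₁ (1 : ℝ)) = v := by simp [← hL₀]
  obtain ⟨j, hj⟩ : ∃ j, α (L₀.symm (EuclideanSpace.single j (1 : ℝ))) ≠ 0 := by
    by_contra! h
    apply hα
    have h1 : α.toLinearMap ∘ₗ L₀.symm.toLinearMap = 0 :=
      (EuclideanSpace.basisFun (Fin n) ℝ).toBasis.ext fun j ↦ by simpa using h j
    ext w
    simpa using congrArg (fun ℓ : _ →ₗ[ℝ] ℝ ↦ ℓ (L₀ w)) h1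
  have hj1 : j ≠ i₁ := by
    rintro rfl
    rw [hL₀s] at hj
    exact hj hαv
  -- Swapping the coordinates j and 0 keeps e₁ fixed, because j ≠ 1, and makes the transported form
  -- β nonzero on e₀.
  let S : EuclideanSpace ℝ (Fin n) ≃L[ℝ] EuclideanSpace ℝ (Fin n) :=
    (LinearIsometryEquiv.piLpCongrLeft 2 ℝ ℝ (Equiv.swap j i₀)).toContinuousLinearEquiv
  let M := L₀.trans S
  let β : EuclideanSpace ℝ (Fin n) →L[ℝ] ℝ := α ∘L (M.symm : _ →L[ℝ] _)
  have hMv : M v = EuclideanSpace.single i₁ 1 := by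
    simp [M, S, hL₀, Equiv.swap_apply_of_ne_of_ne hj1.symm hi]
  have hβ₀ : β (EuclideanSpace.single i₀ 1) ≠ 0 := by
    simpa [β, M, S] using hj
  have hβ₁ : β (EuclideanSpace.single i₁ 1) = 0 := by
    simp [β, ← hMv, hαv]
  -- Replaces the coordinate x₀ by β x: injective since β e₀ ≠ 0, and fixing e₁ since β e₁ = 0.
  let B : EuclideanSpace ℝ (Fin n) →ₗ[ℝ] EuclideanSpace ℝ (Fin n) :=
    LinearMap.id + ((β - EuclideanSpace.proj i₀ : _ →L[ℝ] ℝ).toLinearMap).smulRight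
      (EuclideanSpace.single i₀ (1 : ℝ))
  have hB : ∀ x, B x = x + (β x - x i₀) • EuclideanSpace.single i₀ (1 : ℝ) := fun _ ↦ rfl
  have hB₀ : ∀ x, B x i₀ = β x := fun x ↦ by simp [hB]
  have hBinj : Function.Injective B := by
    rw [injective_iff_map_eq_zero]
    intro x hx
    have h0 : β x = 0 := by rw [← hB₀, hx]; rfl
    rw [hB, h0, zero_sub, neg_smul, ← sub_eq_add_neg, sub_eq_zero] at hx
    rw [hx, map_smul, smul_eq_mul, mul_eq_zero, or_iff_left hβ₀] at h0
    rw [hx, h0, zero_smul]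
  refine ⟨M.trans (LinearEquiv.ofInjectiveEndo B hBinj).toContinuousLinearEquiv, ?_, fun w ↦ ?_⟩
  · change B (M v) = _
    rw [hMv, hB, hβ₁]
    simp [hi.symm, i₁]
  · change B (M w) i₀ = _
    rw [hB₀]
    simp [β]

/-- A function `u` and a vector field `f` annihilated by `du` can be completed to a local
coordinate system in which `u` is the first coordinate and `f` is the second coordinate field. -/
theorem exists_adapted_openPartialHomeomorph (hn : 2 ≤ n)
    {f : EuclideanSpace ℝ (Fin n) → EuclideanSpace ℝ (Fin n)} {u : EuclideanSpace ℝ (Fin n) → ℝ}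
    {U : Set (EuclideanSpace ℝ (Fin n))} (hU : IsOpen U) (hf : ContDiffOn ℝ ∞ f U)
    (hu : ContDiffOn ℝ ∞ u U) (huf : ∀ x ∈ U, fderiv ℝ u x (f x) = 0)
    {p : EuclideanSpace ℝ (Fin n)} (hp : p ∈ U) (hfp : f p ≠ 0) (hup : fderiv ℝ u p ≠ 0) :
    ∃ e : OpenPartialHomeomorph (EuclideanSpace ℝ (Fin n)) (EuclideanSpace ℝ (Fin n)),
      p ∈ e.source ∧ e.source ⊆ U ∧ ContDiffOn ℝ ∞ e e.source ∧ ContDiffOn ℝ ∞ e.symm e.target ∧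
      (∀ x, e x ⟨0, Nat.zero_lt_of_lt hn⟩ = u x) ∧
      ∀ x ∈ e.source, fderiv ℝ e x (f x) = EuclideanSpace.single ⟨1, hn⟩ 1 := by
  obtain ⟨Ξ, V, hV, hpV, hVU, hΞ, hΞp, hΞf⟩ := hf.exists_straightening hU hp hfp
  obtain ⟨L, hLv, hLα⟩ := exists_continuousLinearEquiv_normalForm hn hup hfp (huf p hp)
  let i₀ : Fin n := ⟨0, Nat.zero_lt_of_lt hn⟩
  let pr : EuclideanSpace ℝ (Fin n) →L[ℝ] ℝ := EuclideanSpace.proj i₀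
  let e₀ : EuclideanSpace ℝ (Fin n) := EuclideanSpace.single i₀ 1
  -- The straightening map in normal form, with its 0-th component replaced by u. As L has 0-th
  -- component du at p, the correction has zero derivative at p and G has derivative L there.
  let G : EuclideanSpace ℝ (Fin n) → EuclideanSpace ℝ (Fin n) :=
    fun x ↦ L (Ξ x) + (u x - pr (L (Ξ x))) • e₀
  have hu' := hu.mono hVU
  have hLΞ : ContDiffOn ℝ ∞ (fun x ↦ L (Ξ x)) V := L.contDiff.comp_contDiffOn hΞ
  have hG : ContDiffOn ℝ ∞ G V :=
    hLΞ.add ((hu'.sub (pr.contDiff.comp_contDiffOn hLΞ)).smul contDiffOn_const)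
  have hGd : ∀ x ∈ V, HasFDerivAt G ((L : _ →L[ℝ] _) ∘L fderiv ℝ Ξ x +
      (fderiv ℝ u x - pr ∘L (L : _ →L[ℝ] _) ∘L fderiv ℝ Ξ x).smulRight e₀) x := by
    intro x hx
    have h1 : HasFDerivAt (fun x ↦ L (Ξ x)) ((L : _ →L[ℝ] _) ∘L fderiv ℝ Ξ x) x :=
      L.hasFDerivAt.comp x
        ((hΞ.contDiffAt (hV.mem_nhds hx)).differentiableAt (by simp)).hasFDerivAt
    have h2 := ((hu'.contDiffAt (hV.mem_nhds hx)).differentiableAt (by simp)).hasFDerivAt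
    exact h1.add ((h2.sub (pr.hasFDerivAt.comp x h1)).smul_const e₀)
  have hGp : HasFDerivAt G (L : _ →L[ℝ] _) p := by
    refine (hGd p hpV).congr_fderiv (ContinuousLinearMap.ext fun w ↦ ?_)
    have : pr (L w) = fderiv ℝ u p w := hLα w
    simp [hΞp.fderiv, this]
  obtain ⟨e, he, hpe, heV, hsymm, -⟩ := hG.exists_openPartialHomeomorph hV hpV hGp
  refine ⟨e, hpe, heV.trans hVU, he ▸ hG.mono heV, hsymm, ?_, ?_⟩
  · intro x
    simp [he, G, e₀, i₀, pr]
  · intro x hx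
    rw [he, (hGd x (heV hx)).fderiv]
    -- L ∘ Ξ sends f to e₁, and the correction vanishes along f because du(f) and the 0-th component
    -- of e₁ are both zero.
    have h1 : pr (EuclideanSpace.single ⟨1, hn⟩ 1) = 0 := by simp [pr, i₀]
    simp [hΞf x (heV hx), hLv, huf x (hVU (heV hx)), h1]

end AdaptedChart

/-! ### Vector fields in charts -/

section Manifold

variable {n : ℕ} {M : Type*} [TopologicalSpace M] [ChartedSpace (EuclideanSpace ℝ (Fin n)) M]

theorem mdifferentiable_of_mem_maximalAtlas
    {ψ : OpenPartialHomeomorph M (EuclideanSpace ℝ (Fin n))}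
    (hψ : ψ ∈ IsManifold.maximalAtlas (𝓡 n) ∞ M) : ψ.MDifferentiable (𝓡 n) (𝓡 n) :=
  ⟨(contMDiffOn_of_mem_maximalAtlas hψ).mdifferentiableOn (by simp),
    (contMDiffOn_symm_of_mem_maximalAtlas hψ).mdifferentiableOn (by simp)⟩

theorem isInvertible_mfderiv_of_mem_maximalAtlas
    {ψ : OpenPartialHomeomorph M (EuclideanSpace ℝ (Fin n))}
    (hψ : ψ ∈ IsManifold.maximalAtlas (𝓡 n) ∞ M) {q : M} (hq : q ∈ ψ.source) :
    (mfderiv (𝓡 n) (𝓡 n) ψ q).IsInvertible :=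
  ⟨(mdifferentiable_of_mem_maximalAtlas hψ).mfderiv hq, rfl⟩

/-- The coordinate expression of a vector field in a chart. -/
noncomputable def chartRep (ψ : OpenPartialHomeomorph M (EuclideanSpace ℝ (Fin n)))
    (Z : Π x : M, TangentSpace (𝓡 n) x) (y : EuclideanSpace ℝ (Fin n)) :
    EuclideanSpace ℝ (Fin n) :=
  mfderiv (𝓡 n) (𝓡 n) ψ (ψ.symm y) (Z (ψ.symm y))

theorem chartRep_apply (ψ : OpenPartialHomeomorph M (EuclideanSpace ℝ (Fin n)))
    (Z : Π x : M, TangentSpace (𝓡 n) x) {q : M} (hq : q ∈ ψ.source) :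
    chartRep ψ Z (ψ q) = mfderiv (𝓡 n) (𝓡 n) ψ q (Z q) :=
  congrArg (fun x ↦ (mfderiv (𝓡 n) (𝓡 n) ψ x (Z x) : EuclideanSpace ℝ (Fin n))) (ψ.left_inv hq)

theorem mvfderiv_comp_chart {ψ : OpenPartialHomeomorph M (EuclideanSpace ℝ (Fin n))}
    (hψ : ψ ∈ IsManifold.maximalAtlas (𝓡 n) ∞ M) {u : EuclideanSpace ℝ (Fin n) → ℝ} {q : M}
    (hq : q ∈ ψ.source) (hu : DifferentiableAt ℝ u (ψ q)) (w : TangentSpace (𝓡 n) q) :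
    mvfderiv (𝓡 n) (u ∘ ψ) q w = fderiv ℝ u (ψ q) (mfderiv (𝓡 n) (𝓡 n) ψ q w) := by
  rw [mvfderiv_comp_apply (I' := 𝓡 n) q hu.mdifferentiableAt
    ((mdifferentiable_of_mem_maximalAtlas hψ).mdifferentiableAt hq)]
  simp [mvfderiv, mfderiv_eq_fderiv]
  rfl

variable [IsManifold (𝓡 n) ∞ M]

/-- The vector field on the domain of a chart whose coordinate expression is the constant `w`. -/
noncomputable def chartConstField (ψ : OpenPartialHomeomorph M (EuclideanSpace ℝ (Fin n)))
    (w : EuclideanSpace ℝ (Fin n)) (q : M) : TangentSpace (𝓡 n) q :=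
  mpullback (𝓡 n) (𝓡 n) ψ (fun y ↦ (NormedSpace.fromTangentSpace y).symm w) q

theorem contMDiff_constField (w : EuclideanSpace ℝ (Fin n)) :
    ContMDiff (𝓡 n) ((𝓡 n).prod 𝓘(ℝ, EuclideanSpace ℝ (Fin n))) ∞
      (fun y : EuclideanSpace ℝ (Fin n) ↦ TotalSpace.mk' (EuclideanSpace ℝ (Fin n))
        (E := TangentSpace (𝓡 n)) y ((NormedSpace.fromTangentSpace y).symm w)) :=
  contMDiff_vectorSpace_iff_contDiff.2 (contDiff_const (c := w))

theorem contMDiffAt_chartConstField {ψ : OpenPartialHomeomorph M (EuclideanSpace ℝ (Fin n))}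
    (hψ : ψ ∈ IsManifold.maximalAtlas (𝓡 n) ∞ M) (w : EuclideanSpace ℝ (Fin n)) {q : M}
    (hq : q ∈ ψ.source) :
    ContMDiffAt (𝓡 n) ((𝓡 n).prod 𝓘(ℝ, EuclideanSpace ℝ (Fin n))) ∞
      (fun x ↦ TotalSpace.mk' (EuclideanSpace ℝ (Fin n)) x (chartConstField ψ w x)) q :=
  have : IsManifold (𝓡 n) 1 M := .of_le (n := ∞) (by simp)
  ContMDiffAt.mpullback_vectorField_preimage (contMDiff_constField w _)
    (contMDiffAt_of_mem_maximalAtlas hψ hq) (isInvertible_mfderiv_of_mem_maximalAtlas hψ hq)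
    (by simp)

/-- The bracket is natural under pullback, and constant fields on Euclidean space commute. -/
theorem mlieBracket_chartConstField {ψ : OpenPartialHomeomorph M (EuclideanSpace ℝ (Fin n))}
    (hψ : ψ ∈ IsManifold.maximalAtlas (𝓡 n) ∞ M) (v w : EuclideanSpace ℝ (Fin n)) {q : M}
    (hq : q ∈ ψ.source) :
    mlieBracket (𝓡 n) (chartConstField ψ v) (chartConstField ψ w) q = 0 := by
  have : IsManifold (𝓡 n) (minSmoothness ℝ 2) M := .of_le (n := ∞) (by simpa using ENat.LEInfty.out)
  have h := mpullback_mlieBracket (I := 𝓡 n) (I' := 𝓡 n) (n := ∞)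
    ((contMDiff_constField v (ψ q)).mdifferentiableAt (by simp))
    ((contMDiff_constField w (ψ q)).mdifferentiableAt (by simp))
    (contMDiffAt_of_mem_maximalAtlas hψ hq) (by simpa using ENat.LEInfty.out)
  refine h.symm.trans ?_
  have h0 : mlieBracket (𝓡 n) (fun y : EuclideanSpace ℝ (Fin n) ↦
      (NormedSpace.fromTangentSpace (𝕜 := ℝ) y).symm v)
      (fun y ↦ (NormedSpace.fromTangentSpace y).symm w) (ψ q) = 0 := by
    rw [← mlieBracketWithin_univ, mlieBracketWithin_eq_lieBracketWithin]
    change lieBracketWithin ℝ (fun _ ↦ v) (fun _ ↦ w) univ (ψ q) = 0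
    simp [lieBracketWithin]
  rw [mpullback_apply, h0, map_zero]

/-! ### Null fields and closedness of the dual one-form -/

namespace LorentzMetric

variable (g : LorentzMetric n M)

theorem contMDiffAt_val {X Y : Π x : M, TangentSpace (𝓡 n) x} {x : M}
    (hX : ContMDiffAt (𝓡 n) ((𝓡 n).prod 𝓘(ℝ, EuclideanSpace ℝ (Fin n))) ∞
      (fun y ↦ TotalSpace.mk' (EuclideanSpace ℝ (Fin n)) y (X y)) x)
    (hY : ContMDiffAt (𝓡 n) ((𝓡 n).prod 𝓘(ℝ, EuclideanSpace ℝ (Fin n))) ∞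
      (fun y ↦ TotalSpace.mk' (EuclideanSpace ℝ (Fin n)) y (Y y)) x) :
    ContMDiffAt (𝓡 n) 𝓘(ℝ) ∞ (fun y ↦ g.val y (X y) (Y y)) x := by
  have : ContMDiffAt (𝓡 n) ((𝓡 n).prod 𝓘(ℝ)) ∞
      (fun m ↦ TotalSpace.mk' ℝ (E := Bundle.Trivial M ℝ) m (g.val m (X m) (Y m))) x := by
    apply ContMDiffAt.clm_bundle_apply₂ (F₁ := EuclideanSpace ℝ (Fin n))
      (F₂ := EuclideanSpace ℝ (Fin n))
    · exact g.contMDiff x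
    · exact hX
    · exact hY
  simp only [contMDiffAt_totalSpace] at this
  exact this.2

/-- The signature supplies a timelike basis vector. If it is the only one, g is negative definite
and has no nonzero null vector. -/
theorem two_le_of_isNull {Z : Π x : M, TangentSpace (𝓡 n) x} (hZ : g.IsNull Z) (p : M) :
    2 ≤ n := by
  by_contra! hn
  obtain ⟨e, i₀, he⟩ := g.signature p
  have : Subsingleton (Fin n) := Fin.subsingleton_iff_le_one.2 (by omega)
  have hsum : Z p = e.repr (Z p) i₀ • e i₀ := by
    conv_lhs => rw [← e.sum_repr (Z p)]
    exact Fintype.sum_subsingleton _ i₀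
  obtain ⟨h0, hnull⟩ := hZ p
  rw [hsum] at hnull
  simp [he] at hnull
  exact h0 (by rw [hsum, hnull, zero_smul])

theorem sharp_val (x : M) (v : TangentSpace (𝓡 n) x) : g.sharp x (g.val x v) = v :=
  (g.flat x).symm_apply_apply v

/-- The one-form dual to a covariantly constant vector field is closed. -/
theorem IsCovariantlyConstant.mvfderiv_val_comm {g : LorentzMetric n M}
    {Z X Y : Π x : M, TangentSpace (𝓡 n) x} {x : M} (hconst : g.IsCovariantlyConstant Z)
    (hZ : VFDiffAt Z x) (hX : VFDiffAt X x) (hY : VFDiffAt Y x)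
    (hXY : mlieBracket (𝓡 n) X Y x = 0) :
    mvfderiv (𝓡 n) (fun y ↦ g.val y (Z y) (Y y)) x (X x) =
      mvfderiv (𝓡 n) (fun y ↦ g.val y (Z y) (X y)) x (Y x) := by
  -- With [X, Y] = 0, torsion-freeness gives ∇_X Y = ∇_Y X. Metric compatibility and ∇Z = 0 reduce
  -- the two sides to g(Z, ∇_X Y) and g(Z, ∇_Y X).
  have ht := (CovariantDerivative.torsion_eq_zero_iff _).1 g.leviCivita_torsion hX hY
  rw [hXY, sub_eq_zero] at ht
  rw [g.leviCivita_metric hX hZ hY, g.leviCivita_metric hY hZ hX, hconst x, ht]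
  simp

end LorentzMetric

/-- On the target this is the pullback of Z along the inverse chart, and pullbacks of smooth fields
are smooth. -/
theorem contDiffOn_chartRep {ψ : OpenPartialHomeomorph M (EuclideanSpace ℝ (Fin n))}
    (hψ : ψ ∈ IsManifold.maximalAtlas (𝓡 n) ∞ M) {Z : Π x : M, TangentSpace (𝓡 n) x}
    (hZ : ContMDiff (𝓡 n) ((𝓡 n).prod 𝓘(ℝ, EuclideanSpace ℝ (Fin n))) ∞
      (fun x ↦ TotalSpace.mk' (EuclideanSpace ℝ (Fin n)) x (Z x))) :
    ContDiffOn ℝ ∞ (chartRep ψ Z) ψ.target := by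
  have : IsManifold (𝓡 n) 1 M := .of_le (n := ∞) (by simp)
  have hd := mdifferentiable_of_mem_maximalAtlas hψ
  have hinv : ∀ y ∈ ψ.target, (mfderiv (𝓡 n) (𝓡 n) ψ.symm y).IsInvertible := fun y hy ↦
    ⟨hd.symm.mfderiv hy, rfl⟩
  have heq : EqOn (chartRep ψ Z) (mpullback (𝓡 n) (𝓡 n) ψ.symm Z) ψ.target := by
    intro y hy
    obtain ⟨q, hq, rfl⟩ : ∃ q ∈ ψ.source, ψ q = y := ⟨_, ψ.map_target hy, ψ.right_inv hy⟩
    rw [chartRep_apply ψ Z hq, mpullback_apply]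
    symm
    refine (hinv _ hy).inverse_apply_eq.2 ?_
    have h1 := congrArg (fun A : TangentSpace (𝓡 n) q →L[ℝ] TangentSpace (𝓡 n) q ↦ A (Z q))
      (hd.symm_comp_deriv hq)
    have h2 : (Z (ψ.symm (ψ q)) : EuclideanSpace ℝ (Fin n)) = Z q :=
      congrArg (fun x ↦ (Z x : EuclideanSpace ℝ (Fin n))) (ψ.left_inv hq)
    exact h2.trans h1.symm
  refine ContDiffOn.congr (fun y hy ↦ ContDiffAt.contDiffWithinAt ?_) heq
  exact contMDiffAt_vectorSpace_iff_contDiffAt.1 (ContMDiffAt.mpullback_vectorField_preimage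
    (hZ _) (contMDiffAt_symm_of_mem_maximalAtlas hψ hy) (hinv y hy) (by simp))

/-! ### The dual one-form in coordinates -/

namespace LorentzMetric

variable (g : LorentzMetric n M)

/-- The coordinate expression in a chart of the one-form dual to a vector field. -/
noncomputable def chartDual (ψ : OpenPartialHomeomorph M (EuclideanSpace ℝ (Fin n)))
    (Z : Π x : M, TangentSpace (𝓡 n) x) (y : EuclideanSpace ℝ (Fin n)) :
    EuclideanSpace ℝ (Fin n) →L[ℝ] ℝ :=
  (g.val (ψ.symm y) (Z (ψ.symm y))).comp (mfderiv (𝓡 n) (𝓡 n) ψ (ψ.symm y)).inverse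

theorem chartDual_apply_mfderiv {ψ : OpenPartialHomeomorph M (EuclideanSpace ℝ (Fin n))}
    (hψ : ψ ∈ IsManifold.maximalAtlas (𝓡 n) ∞ M) (Z : Π x : M, TangentSpace (𝓡 n) x) {q : M}
    (hq : q ∈ ψ.source) (w : TangentSpace (𝓡 n) q) :
    g.chartDual ψ Z (ψ q) (mfderiv (𝓡 n) (𝓡 n) ψ q w) = g.val q (Z q) w := by
  have h1 : g.chartDual ψ Z (ψ q) = (g.val q (Z q)).comp (mfderiv (𝓡 n) (𝓡 n) ψ q).inverse :=
    congrArg (fun x ↦ ((g.val x (Z x)).comp (mfderiv (𝓡 n) (𝓡 n) ψ x).inverse :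
      EuclideanSpace ℝ (Fin n) →L[ℝ] ℝ)) (ψ.left_inv hq)
  rw [h1]
  exact congrArg (g.val q (Z q))
    ((isInvertible_mfderiv_of_mem_maximalAtlas hψ hq).inverse_apply_self w)

/-- Smoothness of a family of linear forms can be tested on each fixed w; the value on w is g(Z, W)
read in the chart, W being the field with constant expression w. -/
theorem contDiffOn_chartDual {ψ : OpenPartialHomeomorph M (EuclideanSpace ℝ (Fin n))}
    (hψ : ψ ∈ IsManifold.maximalAtlas (𝓡 n) ∞ M) {Z : Π x : M, TangentSpace (𝓡 n) x}
    (hZ : ContMDiff (𝓡 n) ((𝓡 n).prod 𝓘(ℝ, EuclideanSpace ℝ (Fin n))) ∞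
      (fun x ↦ TotalSpace.mk' (EuclideanSpace ℝ (Fin n)) x (Z x))) :
    ContDiffOn ℝ ∞ (g.chartDual ψ Z) ψ.target := by
  rw [contDiffOn_clm_apply]
  intro w
  rw [← contMDiffOn_iff_contDiffOn]
  have h : ContMDiffOn (𝓡 n) 𝓘(ℝ) ∞ (fun q ↦ g.val q (Z q) (chartConstField ψ w q)) ψ.source :=
    fun q hq ↦ (g.contMDiffAt_val (hZ q)
      (contMDiffAt_chartConstField hψ w hq)).contMDiffWithinAt
  exact h.comp (contMDiffOn_symm_of_mem_maximalAtlas hψ) ψ.mapsTo_symm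

/-- Closedness tested on commuting fields with constant expressions; this symmetry is the hypothesis
of the Poincaré lemma. -/
theorem IsCovariantlyConstant.fderiv_chartDual_comm {g : LorentzMetric n M}
    {ψ : OpenPartialHomeomorph M (EuclideanSpace ℝ (Fin n))}
    (hψ : ψ ∈ IsManifold.maximalAtlas (𝓡 n) ∞ M) {Z : Π x : M, TangentSpace (𝓡 n) x}
    (hZ : ContMDiff (𝓡 n) ((𝓡 n).prod 𝓘(ℝ, EuclideanSpace ℝ (Fin n))) ∞
      (fun x ↦ TotalSpace.mk' (EuclideanSpace ℝ (Fin n)) x (Z x)))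
    (hconst : g.IsCovariantlyConstant Z) {y : EuclideanSpace ℝ (Fin n)} (hy : y ∈ ψ.target)
    (v w : EuclideanSpace ℝ (Fin n)) :
    fderiv ℝ (g.chartDual ψ Z) y v w = fderiv ℝ (g.chartDual ψ Z) y w v := by
  obtain ⟨q, hq, rfl⟩ : ∃ q ∈ ψ.source, ψ q = y := ⟨_, ψ.map_target hy, ψ.right_inv hy⟩
  have hdiff : DifferentiableAt ℝ (g.chartDual ψ Z) (ψ q) :=
    ((g.contDiffOn_chartDual hψ hZ).contDiffAt (ψ.open_target.mem_nhds hy)).differentiableAt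
      (by simp)
  have key : ∀ a b, fderiv ℝ (g.chartDual ψ Z) (ψ q) a b =
      mvfderiv (𝓡 n) (fun x ↦ g.val x (Z x) (chartConstField ψ b x)) q
        (chartConstField ψ a q) := by
    intro a b
    have hb := hdiff.hasFDerivAt.clm_apply (hasFDerivAt_const b (ψ q))
    have h1 : (fun x ↦ g.val x (Z x) (chartConstField ψ b x)) =ᶠ[𝓝 q]
        (fun y ↦ g.chartDual ψ Z y b) ∘ ψ := by
      filter_upwards [ψ.open_source.mem_nhds hq] with x hx
      exact congrArg (fun x ↦ g.val x (Z x) (chartConstField ψ b x)) (ψ.left_inv hx).symm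
    have h2 : mvfderiv (𝓡 n) (fun x ↦ g.val x (Z x) (chartConstField ψ b x)) q =
        mvfderiv (𝓡 n) ((fun y ↦ g.chartDual ψ Z y b) ∘ ψ) q := by
      ext a
      exact congrArg (fun A ↦ (A a : ℝ)) (h1.mfderiv_eq (I := 𝓡 n) (I' := 𝓘(ℝ)))
    rw [h2, mvfderiv_comp_chart hψ hq hb.differentiableAt, hb.fderiv]
    have h3 : mfderiv (𝓡 n) (𝓡 n) ψ q (chartConstField ψ a q) = a :=
      (isInvertible_mfderiv_of_mem_maximalAtlas hψ hq).self_apply_inverse _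
    rw [h3]
    simp
  rw [key, key]
  exact hconst.mvfderiv_val_comm ((hZ q).mdifferentiableAt (by simp))
    ((contMDiffAt_chartConstField hψ v hq).mdifferentiableAt (by simp))
    ((contMDiffAt_chartConstField hψ w hq).mdifferentiableAt (by simp))
    (mlieBracket_chartConstField hψ v w hq)

end LorentzMetric

end Manifold

/-! ### Construction of the chart -/

theorem theorem3p1 {n : ℕ} {M : Type*} [TopologicalSpace M]
    [ChartedSpace (EuclideanSpace ℝ (Fin n)) M] [IsManifold (𝓡 n) ∞ M]
    (g : LorentzMetric n M) (Z : Π x : M, TangentSpace (𝓡 n) x)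
    (hZ : ContMDiff (𝓡 n) ((𝓡 n).prod 𝓘(ℝ, EuclideanSpace ℝ (Fin n))) ∞
      (fun x ↦ TotalSpace.mk' (EuclideanSpace ℝ (Fin n)) x (Z x)))
    (hnull : g.IsNull Z) (hconst : g.IsCovariantlyConstant Z) (p : M) :
    ∃ (hn : 2 ≤ n) (φ : OpenPartialHomeomorph M (EuclideanSpace ℝ (Fin n))),
      φ ∈ IsManifold.maximalAtlas (𝓡 n) ∞ M ∧ p ∈ φ.source ∧
      ∀ q ∈ φ.source,
        Z q = coordField φ ⟨1, hn⟩ q ∧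
        Z q = g.grad (chartCoord φ ⟨0, Nat.zero_lt_of_lt hn⟩) q := by
  have hn := g.two_le_of_isNull hnull p
  let ψ := chartAt (EuclideanSpace ℝ (Fin n)) p
  have hψ : ψ ∈ IsManifold.maximalAtlas (𝓡 n) ∞ M := IsManifold.chart_mem_maximalAtlas p
  have hpψ : p ∈ ψ.source := mem_chart_source _ p
  obtain ⟨r, hr, hball⟩ := Metric.isOpen_iff.1 ψ.open_target (ψ p) (ψ.map_source hpψ)
  have hdual := (g.contDiffOn_chartDual hψ hZ).mono hball
  -- Poincaré lemma on a convex ball: u is a primitive of g(Z, ·) in coordinates.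
  obtain ⟨u, hu⟩ := (convex_ball (ψ p) r).exists_forall_hasFDerivAt_of_fderiv_symmetric
    Metric.isOpen_ball (hdual.differentiableOn (by simp))
    fun y hy v w ↦ hconst.fderiv_chartDual_comm hψ hZ (hball hy) v w
  have husmooth : ContDiffOn ℝ ∞ u (Metric.ball (ψ p) r) := by
    rw [contDiffOn_infty_iff_fderiv_of_isOpen Metric.isOpen_ball]
    exact ⟨fun y hy ↦ (hu y hy).differentiableAt.differentiableWithinAt,
      hdual.congr fun y hy ↦ (hu y hy).fderiv⟩
  have hfderiv : ∀ q ∈ ψ.source, ψ q ∈ Metric.ball (ψ p) r → ∀ w : TangentSpace (𝓡 n) q,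
      fderiv ℝ u (ψ q) (mfderiv (𝓡 n) (𝓡 n) ψ q w) = g.val q (Z q) w := by
    intro q hq hqr w
    rw [(hu _ hqr).fderiv, g.chartDual_apply_mfderiv hψ Z hq]
  have hpr : ψ p ∈ Metric.ball (ψ p) r := Metric.mem_ball_self hr
  -- The side conditions are du(Z) = g(Z, Z) = 0, Z ≠ 0 at p, and du ≠ 0 at p by nondegeneracy of g.
  obtain ⟨e, hpe, her, he, hesymm, he₀, he₁⟩ := exists_adapted_openPartialHomeomorph hn
    (f := chartRep ψ Z) Metric.isOpen_ball ((contDiffOn_chartRep hψ hZ).mono hball) husmooth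
    (fun y hy ↦ by
      obtain ⟨q, hq, rfl⟩ : ∃ q ∈ ψ.source, ψ q = y :=
        ⟨_, ψ.map_target (hball hy), ψ.right_inv (hball hy)⟩
      rw [chartRep_apply ψ Z hq, hfderiv q hq hy]
      exact (hnull q).2)
    hpr
    (by
      rw [chartRep_apply ψ Z hpψ]
      intro h
      exact (hnull p).1
        ((isInvertible_mfderiv_of_mem_maximalAtlas hψ hpψ).injective (h.trans (map_zero _).symm)))
    (by
      intro h
      refine (hnull p).1 (g.eq_zero_of_forall p (Z p) fun w ↦ ?_)
      rw [← hfderiv p hpψ hpr w, h]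
      rfl)
  have hφ : ψ.trans e ∈ IsManifold.maximalAtlas (𝓡 n) ∞ M := by
    apply OpenPartialHomeomorph.mem_maximalAtlas_of_contMDiffOn
    · exact (contMDiffOn_iff_contDiffOn.2 he).comp
        ((contMDiffOn_of_mem_maximalAtlas hψ).mono fun q hq ↦ hq.1) fun q hq ↦ hq.2
    · exact (contMDiffOn_symm_of_mem_maximalAtlas hψ).comp
        ((contMDiffOn_iff_contDiffOn.2 hesymm).mono fun q hq ↦ hq.1) fun q hq ↦ hq.2
  refine ⟨hn, ψ.trans e, hφ, ⟨hpψ, hpe⟩, fun q hq ↦ ⟨?_, ?_⟩⟩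
  · symm
    -- The coordinate field is the inverse differential applied to e₁, so the claim becomes dφ(Z) =
    -- e₁.
    refine (isInvertible_mfderiv_of_mem_maximalAtlas hφ hq).inverse_apply_eq.2 ?_
    have hed : DifferentiableAt ℝ e (ψ q) :=
      (he.contDiffAt (e.open_source.mem_nhds hq.2)).differentiableAt (by simp)
    have h1 : mfderiv (𝓡 n) (𝓡 n) (e ∘ ψ) q =
        (mfderiv (𝓡 n) (𝓡 n) e (ψ q)).comp (mfderiv (𝓡 n) (𝓡 n) ψ q) :=
      mfderiv_comp q hed.mdifferentiableAt
        ((mdifferentiable_of_mem_maximalAtlas hψ).mdifferentiableAt hq.1)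
    have h2 := he₁ (ψ q) hq.2
    rw [chartRep_apply ψ Z hq.1] at h2
    change _ = mfderiv (𝓡 n) (𝓡 n) (e ∘ ψ) q (Z q)
    rw [h1, mfderiv_eq_fderiv]
    exact h2.symm
  · have hcoord : chartCoord (ψ.trans e) ⟨0, Nat.zero_lt_of_lt hn⟩ = u ∘ ψ :=
      funext fun x ↦ he₀ (ψ x)
    have hd : mvfderiv (𝓡 n) (u ∘ ψ) q = g.val q (Z q) := by
      ext w
      rw [mvfderiv_comp_chart hψ hq.1 (hu _ (her hq.2)).differentiableAt,
        hfderiv q hq.1 (her hq.2)]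
    rw [LorentzMetric.grad, hcoord, hd, g.sharp_val]
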